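/- Let $\mu$ be a Borel probability measure on $\mathbb{R}^d$. Let $X_n=(x_1,\dots,x_n)$ be a sample of $n$ independent random points distributed according to $\mu$, and let $P_n^\mu$ be the convex hull of these points. Let $\breve P_n^\mu$ be the interior of $P_n^\mu$ and let $\bar f_0(X_n^\mu)$ be the number of indices $i$ such that $x_i$ lies on the boundary of $P_n^\mu$ (so coincident points are counted with multiplicity); interior and boundary are taken in $\mathbb{R}^d$, not relative to the affine hull. For real $t$ let \[ W_t^\mu=\{x\in\mathbb{R}^d:\ \text{there is a closed half-space } h \text{ with } x\in h \text{ and } \mu(h)\le t\}, \] and let $\bar w^\mu(t)=\mu\bigl(\overline{W_t^\mu}\bigr)$ be the measure of its closure. (i) For every $d$ there is a sequence $\varepsilon_d(n)$ with $\varepsilon_d(n)\to 0$ as $n\to\infty$ such that for every probability measure $\mu$ on $\mathbb{R}^d$ and every $n\ge 2$ \[ \tfrac14\,\bar w^\mu\bigl(\tfrac1n\bigr)\le \mathbb{E}\bigl[1-\mu(\breve P_n^\mu)\bigr]\le \bar w^\mu\bigl((d+2)\tfrac{\ln n}{n}\bigr)+\tfrac{\varepsilon_d(n)}{n} \] and \[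 \tfrac1e\, n\,\bar w^\mu\bigl(\tfrac1n\bigr)\le \mathbb{E}\bigl[\bar f_0(X_n^\mu)\bigr]\le n\,\bar w^\mu\bigl((d+2)\tfrac{\ln n}{n}\bigr)+\varepsilon_d(n). \] (ii) There is a probability measure $\nu$ on $\mathbb{R}^2$ without atoms (every single point has measure $0$) such that, for infinitely many $n$, both \[ \mathbb{E}\bigl[1-\nu(\breve P_n^\nu)\bigr]>\tfrac12\,\bar w^\nu\bigl(\tfrac{\log_2 n}{n}\bigr) \quad\text{and}\quad \mathbb{E}\bigl[\bar f_0(X_n^\nu)\bigr]>\tfrac12\, n\,\bar w^\nu\bigl(\tfrac{\log_2 n}{n}\bigr). \] -/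

import Mathlib

open MeasureTheory Filter Topology

/-- A closed (affine) half-space of `ℝ^d`: a set `{x | ⟪u, x⟫ ≤ c}` with `u ≠ 0`. -/
def IsClosedHalfspace {d : ℕ} (h : Set (EuclideanSpace ℝ (Fin d))) : Prop :=
  ∃ (u : EuclideanSpace ℝ (Fin d)) (c : ℝ), u ≠ 0 ∧ h = {x | inner ℝ u x ≤ c}

/-- The wet part `W_t^μ`: the points that lie in some half-space of `μ`-measure at most `t`. -/
def wetPart {d : ℕ} (μ : Measure (EuclideanSpace ℝ (Fin d))) (t : ℝ) :
    Set (EuclideanSpace ℝ (Fin d)) :=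
  {x | ∃ h : Set (EuclideanSpace ℝ (Fin d)), IsClosedHalfspace h ∧ x ∈ h ∧ μ.real h ≤ t}

/-- The `μ`-measure of the closure of the wet part. -/
noncomputable def closedWetMeasure {d : ℕ} (μ : Measure (EuclideanSpace ℝ (Fin d))) (t : ℝ) : ℝ :=
  μ.real (closure (wetPart μ t))

/-- The joint law of `n` independent random points, each distributed according to `μ`. -/
noncomputable def sampleLaw {d : ℕ} (μ : Measure (EuclideanSpace ℝ (Fin d))) (n : ℕ) :
    Measure (Fin n → EuclideanSpace ℝ (Fin d)) :=
  Measure.pi fun _ => μ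

/-- The polytope spanned by the sample points `x 0, …, x (n - 1)`. -/
def samplePolytope {d n : ℕ} (x : Fin n → EuclideanSpace ℝ (Fin d)) :
    Set (EuclideanSpace ℝ (Fin d)) :=
  convexHull ℝ (Set.range x)

/-- `1 - μ(int P)` for the polytope `P` of the sample `x`; the interior is taken in `ℝ^d`. -/
noncomputable def missedMass {d n : ℕ} (μ : Measure (EuclideanSpace ℝ (Fin d)))
    (x : Fin n → EuclideanSpace ℝ (Fin d)) : ℝ :=
  1 - μ.real (interior (samplePolytope x))

/-- The number of sample points on the boundary, taken in `ℝ^d`, of their convex hull. Indices are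
counted, so coincident sample points are counted with multiplicity. -/
noncomputable def boundaryCount {d n : ℕ} (x : Fin n → EuclideanSpace ℝ (Fin d)) : ℕ :=
  {i : Fin n | x i ∈ frontier (samplePolytope x)}.ncard

/-- The expectation of `1 - μ(int P_n)`. -/
noncomputable def expectedMissedMass {d : ℕ} (μ : Measure (EuclideanSpace ℝ (Fin d))) (n : ℕ) : ℝ :=
  ∫ x, missedMass μ x ∂(sampleLaw μ n)

/-- The expected number of points of an `n`-point sample on the boundary of their hull. -/
noncomputable def expectedBoundaryCount {d : ℕ} (μ : Measure (EuclideanSpace ℝ (Fin d)))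
    (n : ℕ) : ℝ :=
  ∫ x, (boundaryCount x : ℝ) ∂(sampleLaw μ n)

/-!
A point `z` is outside the interior of the hull of `x₁, …, xₙ` exactly when some closed half-space
with `z` on its boundary contains every `xᵢ`; let `escapeProb μ n z` be the probability of this. By
Fubini, `𝔼[1 - μ(int Pₙ)]` is the integral of `escapeProb μ n`, and, singling out one sample point,
`𝔼[f̄₀(Xₙ)]` is `n` times the integral of `escapeProb μ (n - 1)`.

*Lower bounds.* A half-space of measure at most `t` at `z` is missed with probability at least
`(1 - t) ^ n`; since `escapeProb` is upper semicontinuous in `z`, this persists on the closure of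
the wet part.

*Upper bounds.* The inner normals of supporting half-spaces at `z` form a polyhedral cone. Truncated
to the unit box it has a nonzero vertex, which is determined by at most `d` sample points and the
walls of the box, so there are at most `(n + 2d) ^ d` candidates. Off the closed wet part each
candidate half-space has measure less than `1 - t`, and the other `n - d` independent points all
fall in it with probability at most `(1 - t) ^ (n - d)`.

*Sharpness.* Put `ν` on concentric circles of radii `4 ^ k` so that the mass on and outside the
`k`-th circle is `2 * 2 ^ (-3 ^ k)`, and take `n = 4 ^ 3 ^ k`. A half-space of measure at most
`log₂ n / n` stays outside half the `k`-th disc, so the wet part has at most the mass of the outer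
circles. On the other hand with probability more than `1 / 2` no sample point falls beyond the
`k`-th circle, and then no point on or beyond it is interior to the hull.
-/

section ProductSections

variable {α β : Type*} [MeasurableSpace α] [MeasurableSpace β] (μ : Measure α) (ν : Measure β)

theorem integral_measureReal_section_right [IsFiniteMeasure ν] {s : Set (α × β)}
    (hs : MeasurableSet s) : ∫ x, ν.real {y | (x, y) ∈ s} ∂μ = (μ.prod ν).real s := by
  rw [measureReal_def, Measure.prod_apply hs]
  exact integral_toReal (measurable_measure_prodMk_left hs).aemeasurable
    (ae_of_all _ fun _ => measure_lt_top _ _)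

variable [IsFiniteMeasure μ] [IsFiniteMeasure ν]

theorem integral_measureReal_section_left {s : Set (α × β)} (hs : MeasurableSet s) :
    ∫ y, μ.real {x | (x, y) ∈ s} ∂ν = (μ.prod ν).real s := by
  rw [← Measure.prod_swap, map_measureReal_apply measurable_swap hs]
  exact integral_measureReal_section_right ν μ (measurable_swap hs)

theorem integrable_measureReal_section_right {s : Set (α × β)} (hs : MeasurableSet s) :
    Integrable (fun x => ν.real {y | (x, y) ∈ s}) μ :=
  Measure.integrable_measure_prodMk_left hs (measure_ne_top _ _)

theorem integrable_measureReal_section_left {s : Set (α × β)} (hs : MeasurableSet s) :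
    Integrable (fun y => μ.real {x | (x, y) ∈ s}) ν :=
  integrable_measureReal_section_right ν μ (measurable_swap hs)

end ProductSections

theorem le_measureReal_limsup {α : Type*} [MeasurableSpace α] {μ : Measure α} [IsFiniteMeasure μ]
    {A : ℕ → Set α} {c : ℝ} (hA : ∀ k, MeasurableSet (A k)) (hc : ∀ k, c ≤ μ.real (A k)) :
    c ≤ μ.real {x | ∃ᶠ k in atTop, x ∈ A k} := by
  have hset : {x | ∃ᶠ k in atTop, x ∈ A k} = ⋂ j, ⋃ k ≥ j, A k := by
    ext x
    simp [frequently_atTop]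
  have hlim : Tendsto (fun j => μ.real (⋃ k ≥ j, A k)) atTop (𝓝 (μ.real (⋂ j, ⋃ k ≥ j, A k))) :=
    (ENNReal.tendsto_toReal (measure_ne_top _ _)).comp <| tendsto_measure_iInter_atTop
      (fun j => (MeasurableSet.biUnion (Set.to_countable _) fun k _ => hA k).nullMeasurableSet)
      (fun i j hij => Set.biUnion_mono (fun k (hk : j ≤ k) => hij.trans hk) fun _ _ => subset_rfl)
      ⟨0, measure_ne_top _ _⟩
  rw [hset]
  refine ge_of_tendsto' hlim fun j => (hc j).trans ?_
  exact measureReal_mono (Set.subset_iUnion₂_of_subset j le_rfl subset_rfl) (measure_ne_top _ _)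

theorem isClosed_setOf_le_measureReal_section {X Y : Type*} [TopologicalSpace X]
    [MeasurableSpace X] [OpensMeasurableSpace X] [TopologicalSpace Y] [SequentialSpace Y]
    (μ : Measure X) [IsFiniteMeasure μ] {F : Set (X × Y)} (hF : IsClosed F) (c : ℝ) :
    IsClosed {y | c ≤ μ.real {x | (x, y) ∈ F}} := by
  refine IsSeqClosed.isClosed fun w z hw hwz => ?_
  refine (le_measureReal_limsup (fun k => ?_) hw).trans (measureReal_mono fun x hx => ?_)
  · exact (hF.preimage (by fun_prop : Continuous fun x => (x, w k))).measurableSet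
  · exact hF.mem_of_frequently_of_tendsto hx (tendsto_const_nhds.prodMk_nhds hwz)

theorem pi_measure_le_pow {ι α : Type*} [Fintype ι] [MeasurableSpace α] (μ : Measure α)
    [IsProbabilityMeasure μ] (p : ι → Prop) [DecidablePred p] {A : Set (ι → α)}
    (hA : MeasurableSet A) (c : ENNReal)
    (h : ∀ a : {i // p i} → α, ∃ C : Set α, μ C ≤ c ∧
      ∀ x ∈ A, (∀ i : {i // p i}, x i = a i) → ∀ i, ¬ p i → x i ∈ C) :
    Measure.pi (fun _ : ι => μ) A ≤ c ^ Fintype.card {i // ¬ p i} := by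
  let e := MeasurableEquiv.piEquivPiSubtypeProd (fun _ : ι => α) p
  have he := measurePreserving_piEquivPiSubtypeProd (fun _ : ι => μ) p
  have hm : MeasurableSet (e.symm ⁻¹' A) := e.symm.measurable hA
  have hsection : ∀ a : {i // p i} → α, Measure.pi (fun _ : {i // ¬ p i} => μ)
      (Prod.mk a ⁻¹' (e.symm ⁻¹' A)) ≤ c ^ Fintype.card {i // ¬ p i} := fun a => by
    obtain ⟨C, hC, hx⟩ := h a
    have hsub : Prod.mk a ⁻¹' (e.symm ⁻¹' A) ⊆ Set.univ.pi fun _ => C := fun y hy i _ => by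
      have hfix : ∀ i : {i // p i}, e.symm (a, y) i = a i :=
        congrFun (congrArg Prod.fst (e.apply_symm_apply (a, y)))
      have hfree : ∀ i : {i // ¬ p i}, e.symm (a, y) i = y i :=
        congrFun (congrArg Prod.snd (e.apply_symm_apply (a, y)))
      exact hfree i ▸ hx _ hy hfix i i.2
    calc _ ≤ Measure.pi (fun _ : {i // ¬ p i} => μ) (Set.univ.pi fun _ => C) := measure_mono hsub
      _ = μ C ^ Fintype.card {i // ¬ p i} := by simp [Measure.pi_pi]
      _ ≤ _ := by gcongr
  calc Measure.pi (fun _ : ι => μ) A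
      = ((Measure.pi fun _ : {i // p i} => μ).prod (Measure.pi fun _ => μ)) (e.symm ⁻¹' A) := by
        rw [← he.measure_preimage hm.nullMeasurableSet, ← Set.preimage_comp,
          MeasurableEquiv.symm_comp_self, Set.preimage_id]
    _ ≤ ∫⁻ _, c ^ Fintype.card {i // ¬ p i} ∂(Measure.pi fun _ : {i // p i} => μ) := by
        rw [Measure.prod_apply hm]
        exact lintegral_mono hsection
    _ = c ^ Fintype.card {i // ¬ p i} := by simp

section SupportedAt

variable {ι E : Type*} [NormedAddCommGroup E] [InnerProductSpace ℝ E]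

/-- Some closed half-space with `z` on its boundary hyperplane contains all the points `x i`; for a
finite nonempty family this says that `z` is not interior to the convex hull of `x`. -/
def SupportedAt (x : ι → E) (z : E) : Prop :=
  ∃ u : E, u ≠ 0 ∧ ∀ i, 0 ≤ inner ℝ u (x i - z)

theorem supportedAt_iff_exists_norm_eq_one {x : ι → E} {z : E} :
    SupportedAt x z ↔ ∃ u : E, ‖u‖ = 1 ∧ ∀ i, 0 ≤ inner ℝ u (x i - z) := by
  constructor
  · rintro ⟨u, hu, h⟩
    refine ⟨(‖u‖⁻¹ : ℝ) • u, norm_smul_inv_norm (𝕜 := ℝ) hu, fun i => ?_⟩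
    rw [real_inner_smul_left]
    exact mul_nonneg (by positivity) (h i)
  · rintro ⟨u, hu, h⟩
    exact ⟨u, norm_ne_zero_iff.1 (hu.trans_ne one_ne_zero), h⟩

variable (ι E) in
theorem isClosed_setOf_supportedAt [FiniteDimensional ℝ E] :
    IsClosed {p : (ι → E) × E | SupportedAt p.1 p.2} := by
  have : ProperSpace E := FiniteDimensional.proper_real E
  have : CompactSpace (Metric.sphere (0 : E) 1) :=
    isCompact_iff_compactSpace.1 (isCompact_sphere _ _)
  have himage : {p : (ι → E) × E | SupportedAt p.1 p.2} = Prod.snd ''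
      {q : Metric.sphere (0 : E) 1 × ((ι → E) × E) |
        ∀ i, 0 ≤ inner ℝ (q.1 : E) (q.2.1 i - q.2.2)} := by
    ext p
    simp only [supportedAt_iff_exists_norm_eq_one, Set.mem_ofPred_eq, Set.mem_image, Prod.exists,
      Subtype.exists, mem_sphere_zero_iff_norm, exists_eq_right, exists_prop]
  rw [himage]
  apply isClosedMap_snd_of_compactSpace
  simp only [Set.ofPred_forall]
  exact isClosed_iInter fun i => isClosed_le continuous_const (by fun_prop)

theorem mem_closure_setOf_inner_sub_neg {u : E} (hu : u ≠ 0) (z : E) :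
    z ∈ closure {y | inner ℝ u (y - z) < 0} := by
  have htendsto : Tendsto (fun s : ℝ => z - s • u) (𝓝[>] 0) (𝓝 z) := by
    have : Continuous fun s : ℝ => z - s • u := by fun_prop
    simpa using (this.tendsto 0).mono_left nhdsWithin_le_nhds
  refine mem_closure_of_tendsto htendsto ?_
  filter_upwards [self_mem_nhdsWithin] with s (hs : 0 < s)
  simpa [real_inner_smul_right] using mul_pos hs (real_inner_self_pos.2 hu)

theorem SupportedAt.notMem_interior_convexHull {x : ι → E} {z : E} (h : SupportedAt x z) :
    z ∉ interior (convexHull ℝ (Set.range x)) := by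
  obtain ⟨u, hu, hx⟩ := h
  intro hz
  obtain ⟨y, hy, hneg⟩ := mem_closure_iff.1 (mem_closure_setOf_inner_sub_neg hu z) _
    isOpen_interior hz
  have hsub : convexHull ℝ (Set.range x) ⊆ {y | inner ℝ u z ≤ inner ℝ u y} := by
    refine convexHull_min ?_ (convex_halfSpace_ge (innerSL ℝ u).isLinear _)
    rintro _ ⟨i, rfl⟩
    exact sub_nonneg.1 (inner_sub_right (𝕜 := ℝ) u _ _ ▸ hx i)
  have hge : inner ℝ u z ≤ inner ℝ u y := hsub (interior_subset hy)
  have hlt : inner ℝ u (y - z) < 0 := hneg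
  rw [inner_sub_right] at hlt
  linarith

variable [FiniteDimensional ℝ E] [Finite ι] [Nonempty ι]

theorem supportedAt_of_notMem_convexHull {x : ι → E} {z : E}
    (hz : z ∉ convexHull ℝ (Set.range x)) : SupportedAt x z := by
  have hclosed : IsClosed (convexHull ℝ (Set.range x)) :=
    ((Set.finite_range x).isCompact_convexHull ℝ).isClosed
  obtain ⟨f, a, hza, ha⟩ :=
    geometric_hahn_banach_point_closed (convex_convexHull ℝ _) hclosed hz
  have hlt : ∀ i, f z < f (x i) := fun i =>
    hza.trans (ha _ (subset_convexHull ℝ _ (Set.mem_range_self i)))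
  have : CompleteSpace E := FiniteDimensional.complete ℝ E
  refine ⟨(InnerProductSpace.toDual ℝ E).symm f, fun h0 => ?_, fun i => ?_⟩
  · obtain ⟨i⟩ := ‹Nonempty ι›
    simpa [(LinearIsometryEquiv.map_eq_zero_iff _).1 h0] using hlt i
  · rw [InnerProductSpace.toDual_symm_apply, map_sub]
    exact sub_nonneg.2 (hlt i).le

theorem notMem_interior_convexHull_iff_supportedAt {x : ι → E} {z : E} :
    z ∉ interior (convexHull ℝ (Set.range x)) ↔ SupportedAt x z := by
  refine ⟨fun hz => ?_, SupportedAt.notMem_interior_convexHull⟩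
  have hclosed : IsClosed {z | SupportedAt x z} :=
    (isClosed_setOf_supportedAt ι E).preimage (by fun_prop : Continuous fun z => (x, z))
  rw [← Set.mem_compl_iff, ← closure_compl] at hz
  exact closure_minimal (fun w hw => supportedAt_of_notMem_convexHull hw) hclosed hz

end SupportedAt

section EscapeProb

variable {d : ℕ} (μ : Measure (EuclideanSpace ℝ (Fin d)))

theorem sampleLaw_real_forall_mem [SigmaFinite μ] (n : ℕ) (s : Set (EuclideanSpace ℝ (Fin d))) :
    (sampleLaw μ n).real {x | ∀ i, x i ∈ s} = μ.real s ^ n := by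
  have hpi : {x : Fin n → EuclideanSpace ℝ (Fin d) | ∀ i, x i ∈ s} = Set.univ.pi fun _ => s := by
    ext x
    simp
  rw [hpi, measureReal_def, sampleLaw, Measure.pi_pi]
  simp [measureReal_def]

variable [IsProbabilityMeasure μ]

instance (n : ℕ) : IsProbabilityMeasure (sampleLaw μ n) :=
  inferInstanceAs (IsProbabilityMeasure (Measure.pi fun _ => μ))

theorem measurableSet_setOf_supportedAt (d n : ℕ) : MeasurableSet
    {p : (Fin n → EuclideanSpace ℝ (Fin d)) × EuclideanSpace ℝ (Fin d) | SupportedAt p.1 p.2} :=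
  (isClosed_setOf_supportedAt _ _).measurableSet

/-- The probability that `n` random points are supported at `z`, that is, for `n ≠ 0`, that `z` is
not interior to their convex hull. -/
noncomputable def escapeProb (n : ℕ) (z : EuclideanSpace ℝ (Fin d)) : ℝ :=
  (sampleLaw μ n).real {x | SupportedAt x z}

theorem integrable_escapeProb (n : ℕ) : Integrable (escapeProb μ n) μ :=
  integrable_measureReal_section_left _ _ (measurableSet_setOf_supportedAt d n)

theorem missedMass_eq {n : ℕ} [NeZero n] (x : Fin n → EuclideanSpace ℝ (Fin d)) :
    missedMass μ x = μ.real {z | SupportedAt x z} := by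
  rw [missedMass, ← probReal_compl_eq_one_sub isOpen_interior.measurableSet]
  congr 1 with z
  exact notMem_interior_convexHull_iff_supportedAt

theorem integrable_missedMass (n : ℕ) [NeZero n] :
    Integrable (fun x : Fin n → EuclideanSpace ℝ (Fin d) => missedMass μ x) (sampleLaw μ n) := by
  simp only [missedMass_eq]
  exact integrable_measureReal_section_right _ _ (measurableSet_setOf_supportedAt d n)

theorem expectedMissedMass_eq (n : ℕ) [NeZero n] :
    expectedMissedMass μ n = ∫ z, escapeProb μ n z ∂μ := by
  simp only [expectedMissedMass, missedMass_eq, escapeProb]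
  exact (integral_measureReal_section_right _ _ (measurableSet_setOf_supportedAt d n)).trans
    (integral_measureReal_section_left _ _ (measurableSet_setOf_supportedAt d n)).symm

theorem boundaryCount_eq {n : ℕ} (x : Fin n → EuclideanSpace ℝ (Fin d)) :
    (boundaryCount x : ℝ) = ∑ i, {x | SupportedAt x (x i)}.indicator (fun _ => (1 : ℝ)) x := by
  classical
  have hmem : ∀ i, x i ∈ frontier (samplePolytope x) ↔ SupportedAt x (x i) := fun i => by
    have : Nonempty (Fin n) := ⟨i⟩
    rw [frontier, Set.mem_sdiff, samplePolytope, notMem_interior_convexHull_iff_supportedAt]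
    exact and_iff_right (subset_closure (subset_convexHull ℝ _ (Set.mem_range_self i)))
  simp only [boundaryCount, hmem, Set.indicator_apply, Set.mem_ofPred_eq, Finset.sum_boole,
    Set.ncard_eq_toFinset_card', Set.toFinset_ofPred]

theorem measurableSet_setOf_supportedAt_self {n : ℕ} (i : Fin n) :
    MeasurableSet {x : Fin n → EuclideanSpace ℝ (Fin d) | SupportedAt x (x i)} :=
  ((isClosed_setOf_supportedAt _ _).preimage
    (by fun_prop : Continuous fun x : Fin n → EuclideanSpace ℝ (Fin d) => (x, x i))).measurableSet

theorem integrable_boundaryCount (n : ℕ) :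
    Integrable (fun x : Fin n → EuclideanSpace ℝ (Fin d) => (boundaryCount x : ℝ))
      (sampleLaw μ n) := by
  simp only [boundaryCount_eq]
  exact integrable_finsetSum _ fun i _ =>
    (integrable_const 1).indicator (measurableSet_setOf_supportedAt_self i)

theorem supportedAt_self_iff_removeNth {n : ℕ} (i : Fin (n + 1))
    (x : Fin (n + 1) → EuclideanSpace ℝ (Fin d)) :
    SupportedAt x (x i) ↔ SupportedAt (i.removeNth x) (x i) := by
  simp [SupportedAt, Fin.forall_iff_succAbove i, Fin.removeNth]

theorem sampleLaw_real_setOf_supportedAt_self (n : ℕ) (i : Fin (n + 1)) :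
    (sampleLaw μ (n + 1)).real {x | SupportedAt x (x i)} = ∫ z, escapeProb μ n z ∂μ := by
  have hs := measurable_swap (measurableSet_setOf_supportedAt d n)
  simp only [supportedAt_self_iff_removeNth]
  exact (congrArg ENNReal.toReal ((measurePreserving_piFinSuccAbove (fun _ => μ) i).measure_preimage
    hs.nullMeasurableSet)).trans (integral_measureReal_section_right μ (sampleLaw μ n) hs).symm

theorem expectedBoundaryCount_eq (n : ℕ) :
    expectedBoundaryCount μ n = n * ∫ z, escapeProb μ (n - 1) z ∂μ := by
  have hterm : ∀ i : Fin n, ∫ x, {x | SupportedAt x (x i)}.indicator (fun _ => (1 : ℝ)) x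
      ∂(sampleLaw μ n) = ∫ z, escapeProb μ (n - 1) z ∂μ := fun i => by
    obtain ⟨m, rfl⟩ := Nat.exists_eq_add_one.2 i.pos
    rw [integral_indicator_const _ (measurableSet_setOf_supportedAt_self i), smul_eq_mul, mul_one]
    exact sampleLaw_real_setOf_supportedAt_self μ m i
  simp only [expectedBoundaryCount, boundaryCount_eq]
  rw [integral_finsetSum _ fun i _ =>
    (integrable_const 1).indicator (measurableSet_setOf_supportedAt_self i)]
  simp [hterm]

theorem mul_measureReal_le_integral_escapeProb {n : ℕ} {c : ℝ} (hc : 0 ≤ c)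
    {S : Set (EuclideanSpace ℝ (Fin d))} (hS : ∀ z ∈ S, c ≤ escapeProb μ n z) :
    c * μ.real S ≤ ∫ z, escapeProb μ n z ∂μ :=
  (mul_le_mul_of_nonneg_left (measureReal_mono hS) hc).trans
    (mul_meas_ge_le_integral_of_nonneg (ae_of_all _ fun _ => measureReal_nonneg)
      (integrable_escapeProb μ n) c)

theorem pow_measureReal_le_escapeProb (n : ℕ) {u : EuclideanSpace ℝ (Fin d)} (hu : u ≠ 0)
    (z : EuclideanSpace ℝ (Fin d)) :
    μ.real {y | 0 ≤ inner ℝ u (y - z)} ^ n ≤ escapeProb μ n z := by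
  rw [← sampleLaw_real_forall_mem]
  exact measureReal_mono fun x hx => ⟨u, hu, hx⟩

end EscapeProb

section LowerBound

variable {d : ℕ} (μ : Measure (EuclideanSpace ℝ (Fin d))) [IsProbabilityMeasure μ]

theorem IsClosedHalfspace.measurableSet {h : Set (EuclideanSpace ℝ (Fin d))}
    (hh : IsClosedHalfspace h) : MeasurableSet h := by
  obtain ⟨u, c, -, rfl⟩ := hh
  exact measurableSet_le (by fun_prop) measurable_const

theorem one_sub_pow_le_escapeProb_of_mem_wetPart {t : ℝ} (ht : t ≤ 1) (n : ℕ)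
    {z : EuclideanSpace ℝ (Fin d)} (hz : z ∈ wetPart μ t) : (1 - t) ^ n ≤ escapeProb μ n z := by
  obtain ⟨h, hh, hzh, hμ⟩ := hz
  have hcompl : 1 - t ≤ μ.real hᶜ := by
    rw [probReal_compl_eq_one_sub hh.measurableSet]
    linarith
  obtain ⟨u, c, hu, rfl⟩ := hh
  have hsub : {x | inner ℝ u x ≤ c}ᶜ ⊆ {y | 0 ≤ inner ℝ u (y - z)} := fun y hy => by
    have hyc : c < inner ℝ u y := not_le.1 hy
    have hzc : inner ℝ u z ≤ c := hzh
    rw [Set.mem_ofPred_eq, inner_sub_right]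
    linarith
  exact (pow_le_pow_left₀ (by linarith) (hcompl.trans (measureReal_mono hsub)) n).trans
    (pow_measureReal_le_escapeProb μ n hu z)

theorem one_sub_pow_mul_closedWetMeasure_le {t : ℝ} (ht : t ≤ 1) (n : ℕ) :
    (1 - t) ^ n * closedWetMeasure μ t ≤ ∫ z, escapeProb μ n z ∂μ := by
  have hclosed : IsClosed {z | (1 - t) ^ n ≤ escapeProb μ n z} :=
    isClosed_setOf_le_measureReal_section (sampleLaw μ n) (isClosed_setOf_supportedAt _ _) _
  exact mul_measureReal_le_integral_escapeProb μ (pow_nonneg (by linarith) n) fun z hz =>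
    closure_minimal (fun w hw => one_sub_pow_le_escapeProb_of_mem_wetPart μ ht n hw) hclosed hz

end LowerBound

section BasicSolution

open scoped Matrix

variable {ι κ : Type*} [Fintype ι]

theorem eq_zero_of_mem_extremePoints_of_mulVec_eq_zero [Finite κ] {A : Matrix κ ι ℝ} {c : κ → ℝ}
    {w : ι → ℝ} (hw : w ∈ Set.extremePoints ℝ {w | A *ᵥ w ≤ c}) {p : ι → ℝ}
    (hp : ∀ k, (A *ᵥ w) k = c k → (A *ᵥ p) k = 0) : p = 0 := by
  have hev : ∀ᶠ s : ℝ in 𝓝 0, A *ᵥ (w + s • p) ≤ c := by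
    refine eventually_all.2 fun k => ?_
    simp only [Matrix.mulVec_add, Matrix.mulVec_smul, Pi.add_apply, Pi.smul_apply, smul_eq_mul]
    rcases (hw.1 k).eq_or_lt with hk | hk
    · simp [hp k hk, hk]
    · have hcont : Continuous fun s : ℝ => (A *ᵥ w) k + s * (A *ᵥ p) k := by fun_prop
      exact ((hcont.tendsto' 0 ((A *ᵥ w) k) (by simp)).eventually (gt_mem_nhds hk)).mono
        fun s hs => hs.le
  have hneg : ∀ᶠ s : ℝ in 𝓝 0, A *ᵥ (w + (-s) • p) ≤ c :=
    (continuous_neg.tendsto' 0 0 neg_zero).eventually hev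
  obtain ⟨s, ⟨hs, hs'⟩, hpos : 0 < s⟩ := (((hev.and hneg).filter_mono
    nhdsWithin_le_nhds).and (self_mem_nhdsWithin (s := Set.Ioi 0))).exists
  have hmid : w ∈ openSegment ℝ (w + s • p) (w + (-s) • p) :=
    ⟨1 / 2, 1 / 2, by norm_num, by norm_num, by norm_num, by module⟩
  have hsp : s • p = 0 := by simpa using (mem_extremePoints_iff_left.1 hw).2 _ hs _ hs' hmid
  exact (smul_eq_zero.1 hsp).resolve_left hpos.ne'

theorem span_activeRows_eq_top [Finite κ] {A : Matrix κ ι ℝ} {c : κ → ℝ} {w : ι → ℝ}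
    (hw : w ∈ Set.extremePoints ℝ {w | A *ᵥ w ≤ c}) :
    Submodule.span ℝ (A.row '' {k | (A *ᵥ w) k = c k}) = ⊤ := by
  classical
  by_contra hne
  obtain ⟨f, hf, hker⟩ := Submodule.exists_le_ker_of_lt_top _ (lt_top_iff_ne_top.2 hne)
  obtain ⟨p, rfl⟩ := (dotProductEquiv ℝ ι).surjective f
  refine hf ?_
  rw [eq_zero_of_mem_extremePoints_of_mulVec_eq_zero hw (p := p) fun k hk => ?_, map_zero]
  have hrow : p ⬝ᵥ A.row k = 0 :=
    hker (Submodule.subset_span (Set.mem_image_of_mem _ hk))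
  rwa [dotProduct_comm] at hrow

theorem exists_isUnit_submatrix_of_span_rows_eq_top [DecidableEq ι] {A : Matrix κ ι ℝ} {T : Set κ}
    (hT : Submodule.span ℝ (A.row '' T) = ⊤) :
    ∃ g : ι → κ, (∀ i, g i ∈ T) ∧ IsUnit (A.submatrix g id) := by
  let B := Module.Basis.ofSpan hT.ge
  let e := (Pi.basisFun ℝ ι).indexEquiv B
  choose g hgT hg using fun i => Module.Basis.ofSpan_subset hT.ge (Set.mem_range_self (e i))
  refine ⟨g, hgT, Matrix.linearIndependent_rows_iff_isUnit.1 ?_⟩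
  have hrow : (A.submatrix g id).row = B ∘ e := funext hg
  exact hrow ▸ B.linearIndependent.comp e e.injective

/-- The basic solution, in the sense of linear programming, of the system `A *ᵥ w ≤ c` at the rows
`g`: the vector for which these rows are equalities. It is `0` if the rows are dependent. -/
noncomputable def basicSolution [DecidableEq ι] (A : Matrix κ ι ℝ) (c : κ → ℝ) (g : ι → κ) :
    ι → ℝ :=
  (A.submatrix g id)⁻¹ *ᵥ (c ∘ g)

theorem exists_basicSolution_eq_of_mem_extremePoints [DecidableEq ι] [Finite κ]
    {A : Matrix κ ι ℝ} {c : κ → ℝ} {w : ι → ℝ}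
    (hw : w ∈ Set.extremePoints ℝ {w | A *ᵥ w ≤ c}) : ∃ g, basicSolution A c g = w := by
  obtain ⟨g, hg, hunit⟩ := exists_isUnit_submatrix_of_span_rows_eq_top (span_activeRows_eq_top hw)
  have hsolves : A.submatrix g id *ᵥ w = c ∘ g := funext hg
  refine ⟨g, ?_⟩
  rw [basicSolution, ← hsolves, Matrix.mulVec_mulVec,
    Matrix.nonsing_inv_mul _ ((Matrix.isUnit_iff_isUnit_det _).1 hunit), Matrix.one_mulVec]

theorem exists_mem_extremePoints_ne_zero {E : Type*} [AddCommGroup E] [Module ℝ E]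
    [TopologicalSpace E] [T2Space E] [IsTopologicalAddGroup E] [ContinuousSMul ℝ E]
    [LocallyConvexSpace ℝ E] {K : Set E} (hK : IsCompact K) (hconv : Convex ℝ K) {u : E}
    (hu : u ∈ K) (hu0 : u ≠ 0) : ∃ w ∈ Set.extremePoints ℝ K, w ≠ 0 := by
  by_contra! hzero
  have hsub : closure (convexHull ℝ (Set.extremePoints ℝ K)) ⊆ {0} :=
    closure_minimal (convexHull_min hzero (convex_singleton 0)) isClosed_singleton
  rw [closure_convexHull_extremePoints hK hconv] at hsub
  exact hu0 (hsub hu)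

variable [DecidableEq ι]

/-- The constraint matrix of the cone `0 ≤ V *ᵥ w` truncated by the cube `-1 ≤ w ≤ 1`. -/
def truncatedConeMatrix (V : Matrix κ ι ℝ) : Matrix (κ ⊕ ι ⊕ ι) ι ℝ :=
  Matrix.fromRows (-V) (Matrix.fromRows 1 (-1))

/-- The right-hand sides of the constraints `truncatedConeMatrix`. -/
def truncatedConeBound : κ ⊕ ι ⊕ ι → ℝ :=
  Sum.elim 0 1

theorem truncatedConeMatrix_mulVec_le_iff {V : Matrix κ ι ℝ} {w : ι → ℝ} :
    truncatedConeMatrix V *ᵥ w ≤ truncatedConeBound ↔ 0 ≤ V *ᵥ w ∧ w ∈ Set.Icc (-1) 1 := by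
  simp only [truncatedConeMatrix, truncatedConeBound, Matrix.fromRows_mulVec, Matrix.neg_mulVec,
    Matrix.one_mulVec, Pi.le_def, Sum.forall, Sum.elim_inl, Sum.elim_inr, Pi.neg_apply,
    Pi.zero_apply, Pi.one_apply, Left.neg_nonpos_iff, Set.mem_Icc, neg_le, and_comm]

theorem isCompact_truncatedCone (V : Matrix κ ι ℝ) :
    IsCompact {w | truncatedConeMatrix V *ᵥ w ≤ truncatedConeBound} := by
  refine isCompact_Icc.of_isClosed_subset (isClosed_le (by fun_prop) continuous_const)
    fun w hw => (truncatedConeMatrix_mulVec_le_iff.1 hw).2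

theorem exists_basicSolution_mem_cone [Finite κ] {V : Matrix κ ι ℝ} {u : ι → ℝ} (hu : u ≠ 0)
    (hV : 0 ≤ V *ᵥ u) :
    ∃ g, basicSolution (truncatedConeMatrix V) truncatedConeBound g ≠ 0 ∧
      0 ≤ V *ᵥ basicSolution (truncatedConeMatrix V) truncatedConeBound g := by
  have hconv : Convex ℝ {w | truncatedConeMatrix V *ᵥ w ≤ truncatedConeBound} :=
    (convex_Iic _).linear_preimage (Matrix.mulVecLin (truncatedConeMatrix V))
  have hmem : ‖u‖⁻¹ • u ∈ {w | truncatedConeMatrix V *ᵥ w ≤ truncatedConeBound} := by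
    refine truncatedConeMatrix_mulVec_le_iff.2 ⟨?_, ?_⟩
    · rw [Matrix.mulVec_smul]
      exact smul_nonneg (by positivity) hV
    · have hnorm : ‖‖u‖⁻¹ • u‖ = 1 := norm_smul_inv_norm (𝕜 := ℝ) hu
      have hcoord := fun i => abs_le.1 ((norm_le_pi_norm (‖u‖⁻¹ • u) i).trans hnorm.le)
      exact ⟨fun i => (hcoord i).1, fun i => (hcoord i).2⟩
  obtain ⟨w, hw, hw0⟩ := exists_mem_extremePoints_ne_zero (isCompact_truncatedCone V) hconv hmem
    (smul_ne_zero (inv_ne_zero (norm_ne_zero_iff.2 hu)) hu)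
  obtain ⟨g, rfl⟩ := exists_basicSolution_eq_of_mem_extremePoints hw
  exact ⟨g, hw0, (truncatedConeMatrix_mulVec_le_iff.1 hw.1).1⟩

end BasicSolution

section ConeVertex

variable {ι κ : Type*} [Fintype ι]

theorem card_sub_card_le_card_unselected [Fintype κ] (g : ι → κ ⊕ ι ⊕ ι)
    [DecidablePred fun i => ∃ k, g k = Sum.inl i] :
    Fintype.card κ - Fintype.card ι ≤ Fintype.card {i // ¬ ∃ k, g k = Sum.inl i} := by
  have hinj : Function.Injective fun i : {i // ∃ k, g k = Sum.inl i} => i.2.choose :=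
    fun i j hij => Subtype.ext <| Sum.inl_injective <|
      i.2.choose_spec.symm.trans ((congrArg g hij).trans j.2.choose_spec)
  have hselected := Fintype.card_le_of_injective _ hinj
  rw [Fintype.card_subtype_compl]
  omega

variable [DecidableEq ι]

/-- The candidate vertex, indexed by a choice `g` of constraints, of the cone of the directions
having nonnegative inner product with every `v i`, truncated by a cube. -/
noncomputable def coneVertex (g : ι → κ ⊕ ι ⊕ ι) (v : κ → EuclideanSpace ℝ ι) :
    EuclideanSpace ℝ ι :=
  WithLp.toLp 2 (basicSolution (truncatedConeMatrix (Matrix.of fun i => (v i).ofLp))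
    truncatedConeBound g)

theorem exists_coneVertex_ne_zero [Finite κ] {v : κ → EuclideanSpace ℝ ι}
    {u : EuclideanSpace ℝ ι} (hu : u ≠ 0) (hv : ∀ i, 0 ≤ inner ℝ u (v i)) :
    ∃ g, coneVertex g v ≠ 0 ∧ ∀ i, 0 ≤ inner ℝ (coneVertex g v) (v i) := by
  simp only [EuclideanSpace.inner_eq_star_dotProduct, star_trivial] at hv ⊢
  obtain ⟨g, hg, hcone⟩ := exists_basicSolution_mem_cone
    (V := Matrix.of fun i => (v i).ofLp) ((WithLp.ofLp_eq_zero 2).not.2 hu) hv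
  exact ⟨g, (WithLp.toLp_eq_zero 2).not.2 hg, hcone⟩

theorem coneVertex_congr {g : ι → κ ⊕ ι ⊕ ι} {v v' : κ → EuclideanSpace ℝ ι}
    (h : ∀ i k, g k = Sum.inl i → v i = v' i) : coneVertex g v = coneVertex g v' := by
  rw [coneVertex, coneVertex, basicSolution, basicSolution]
  congr 3
  ext k j
  rcases hk : g k with i | l
  · simp [truncatedConeMatrix, hk, h i k hk]
  · simp [truncatedConeMatrix, hk]

theorem measurable_coneVertex [Countable κ] (g : ι → κ ⊕ ι ⊕ ι) : Measurable (coneVertex g) := by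
  have hcont : Continuous fun v : κ → EuclideanSpace ℝ ι =>
      (truncatedConeMatrix (Matrix.of fun i => (v i).ofLp)).submatrix g id := by
    refine continuous_matrix fun k j => ?_
    rcases hk : g k with i | l
    · simp only [truncatedConeMatrix, Matrix.submatrix_apply, hk, Matrix.fromRows_apply_inl,
        Matrix.neg_apply, Matrix.of_apply, id]
      fun_prop
    · simp only [truncatedConeMatrix, Matrix.submatrix_apply, hk, Matrix.fromRows_apply_inr]
      fun_prop
  unfold coneVertex basicSolution
  simp only [Matrix.inv_def, Matrix.smul_mulVec, Ring.inverse_eq_inv', WithLp.toLp_smul]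
  exact hcont.matrix_det.measurable.inv.smul ((PiLp.continuous_toLp 2 _).comp
    (hcont.matrix_adjugate.matrix_mulVec continuous_const)).measurable

end ConeVertex

section UpperBound

variable {d : ℕ} (μ : Measure (EuclideanSpace ℝ (Fin d))) [IsProbabilityMeasure μ]

/-- The samples for which the truncated-cone vertex indexed by `g` is an inner normal of a
supporting half-space at `z`. -/
def coneVertexEvent {m : ℕ} (g : Fin d → Fin m ⊕ Fin d ⊕ Fin d) (z : EuclideanSpace ℝ (Fin d)) :
    Set (Fin m → EuclideanSpace ℝ (Fin d)) :=
  {x | coneVertex g (fun i => x i - z) ≠ 0 ∧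
    ∀ i, 0 ≤ inner ℝ (coneVertex g fun i => x i - z) (x i - z)}

theorem measurableSet_coneVertexEvent {m : ℕ} (g : Fin d → Fin m ⊕ Fin d ⊕ Fin d)
    (z : EuclideanSpace ℝ (Fin d)) : MeasurableSet (coneVertexEvent g z) := by
  have hedge : ∀ i, Measurable fun x : Fin m → EuclideanSpace ℝ (Fin d) => x i - z :=
    fun i => ((continuous_apply i).sub continuous_const).measurable
  have hvertex := (measurable_coneVertex g).comp (measurable_pi_lambda _ hedge)
  simp only [coneVertexEvent, Set.ofPred_and, Set.ofPred_forall]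
  exact (hvertex (measurableSet_singleton 0).compl).inter
    (MeasurableSet.iInter fun i => measurableSet_le measurable_const (hvertex.inner (hedge i)))

theorem setOf_supportedAt_subset_iUnion_coneVertexEvent (m : ℕ) (z : EuclideanSpace ℝ (Fin d)) :
    {x : Fin m → EuclideanSpace ℝ (Fin d) | SupportedAt x z} ⊆ ⋃ g, coneVertexEvent g z := by
  rintro x ⟨u, hu, hx⟩
  exact Set.mem_iUnion.2 (exists_coneVertex_ne_zero hu hx)

variable {c : ℝ} {z : EuclideanSpace ℝ (Fin d)}

theorem sampleLaw_coneVertexEvent_le (hc0 : 0 ≤ c) (hc1 : c ≤ 1)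
    (hz : ∀ u : EuclideanSpace ℝ (Fin d), u ≠ 0 → μ.real {y | 0 ≤ inner ℝ u (y - z)} ≤ c)
    {m : ℕ} (g : Fin d → Fin m ⊕ Fin d ⊕ Fin d) :
    (sampleLaw μ m).real (coneVertexEvent g z) ≤ c ^ (m - d) := by
  classical
  have hpow : sampleLaw μ m (coneVertexEvent g z) ≤
      ENNReal.ofReal c ^ Fintype.card {i // ¬ ∃ k, g k = Sum.inl i} := by
    refine pi_measure_le_pow μ _ (measurableSet_coneVertexEvent g z) _ fun a => ?_
    let x₀ : Fin m → EuclideanSpace ℝ (Fin d) :=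
      fun i => if h : ∃ k, g k = Sum.inl i then a ⟨i, h⟩ else 0
    let w := coneVertex g fun i => x₀ i - z
    have hw : ∀ x : Fin m → EuclideanSpace ℝ (Fin d),
        (∀ i : {i // ∃ k, g k = Sum.inl i}, x i = a i) → coneVertex g (fun i => x i - z) = w := by
      refine fun x hx => coneVertex_congr fun i k hk => ?_
      have hi : ∃ k, g k = Sum.inl i := ⟨k, hk⟩
      simp only [x₀, dif_pos hi, hx ⟨i, hi⟩]
    by_cases hw0 : w = 0
    · exact ⟨∅, by simp, fun x hx hxa => absurd ((hw x hxa).trans hw0) hx.1⟩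
    · refine ⟨{y | 0 ≤ inner ℝ w (y - z)}, ?_, fun x hx hxa i _ => ?_⟩
      · rw [← ofReal_measureReal]
        exact ENNReal.ofReal_le_ofReal (hz w hw0)
      · exact hw x hxa ▸ hx.2 i
  rw [← ENNReal.ofReal_pow hc0] at hpow
  refine (ENNReal.toReal_le_of_le_ofReal (by positivity) hpow).trans
    (pow_le_pow_of_le_one hc0 hc1 ?_)
  simpa only [Fintype.card_fin] using card_sub_card_le_card_unselected g

theorem escapeProb_le (hc0 : 0 ≤ c) (hc1 : c ≤ 1)
    (hz : ∀ u : EuclideanSpace ℝ (Fin d), u ≠ 0 → μ.real {y | 0 ≤ inner ℝ u (y - z)} ≤ c)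
    (m : ℕ) : escapeProb μ m z ≤ (m + 2 * d) ^ d * c ^ (m - d) := by
  calc escapeProb μ m z
      ≤ (sampleLaw μ m).real (⋃ g, coneVertexEvent g z) :=
        measureReal_mono (setOf_supportedAt_subset_iUnion_coneVertexEvent m z)
    _ ≤ ∑ g, (sampleLaw μ m).real (coneVertexEvent g z) := measureReal_iUnion_fintype_le _
    _ ≤ ∑ _g : Fin d → Fin m ⊕ Fin d ⊕ Fin d, c ^ (m - d) :=
        Finset.sum_le_sum fun g _ => sampleLaw_coneVertexEvent_le μ hc0 hc1 hz g
    _ = (m + 2 * d) ^ d * c ^ (m - d) := by simp [two_mul]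

theorem lt_measureReal_of_notMem_closure_wetPart {t : ℝ} (hz : z ∉ closure (wetPart μ t))
    {u : EuclideanSpace ℝ (Fin d)} (hu : u ≠ 0) : t < μ.real {y | inner ℝ u (y - z) < 0} := by
  obtain ⟨w, hw, hneg⟩ := mem_closure_iff.1 (mem_closure_setOf_inner_sub_neg hu z) _
    isClosed_closure.isOpen_compl hz
  by_contra! hle
  refine hw (subset_closure ⟨{y | inner ℝ u y ≤ inner ℝ u w}, ⟨u, _, hu, rfl⟩, ?_, ?_⟩)
  · exact le_refl (inner ℝ u w)
  · refine (measureReal_mono fun y hy => ?_).trans hle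
    simp only [Set.mem_ofPred_eq, inner_sub_right] at hy hneg ⊢
    linarith

theorem escapeProb_le_of_notMem_closure_wetPart {t : ℝ} (ht : 0 ≤ t)
    (hz : z ∉ closure (wetPart μ t)) (m : ℕ) :
    escapeProb μ m z ≤ (m + 2 * d) ^ d * Real.exp (-t) ^ (m - d) := by
  refine escapeProb_le μ (Real.exp_pos _).le (Real.exp_le_one_iff.2 (by linarith))
    (fun u hu => ?_) m
  have hcompl : {y | 0 ≤ inner ℝ u (y - z)} = {y | inner ℝ u (y - z) < 0}ᶜ := by
    ext y
    simp
  rw [hcompl, probReal_compl_eq_one_sub (measurableSet_lt (by fun_prop) measurable_const)]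
  linarith [lt_measureReal_of_notMem_closure_wetPart μ hz hu, Real.add_one_le_exp (-t)]

theorem integral_escapeProb_le {t : ℝ} (ht : 0 ≤ t) (m : ℕ) :
    ∫ z, escapeProb μ m z ∂μ ≤
      closedWetMeasure μ t + (m + 2 * d) ^ d * Real.exp (-t) ^ (m - d) := by
  have hind : Integrable ((closure (wetPart μ t)).indicator fun _ => (1 : ℝ)) μ :=
    (integrable_const 1).indicator isClosed_closure.measurableSet
  calc ∫ z, escapeProb μ m z ∂μ
      ≤ ∫ z, ((closure (wetPart μ t)).indicator (fun _ => (1 : ℝ)) z +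
          (m + 2 * d) ^ d * Real.exp (-t) ^ (m - d)) ∂μ := by
        refine integral_mono (integrable_escapeProb μ m) (hind.add (integrable_const _))
          fun z => ?_
        by_cases hz : z ∈ closure (wetPart μ t)
        · rw [Set.indicator_of_mem hz]
          exact measureReal_le_one.trans (le_add_of_nonneg_right (by positivity))
        · rw [Set.indicator_of_notMem hz, zero_add]
          exact escapeProb_le_of_notMem_closure_wetPart μ ht hz m
    _ = closedWetMeasure μ t + (m + 2 * d) ^ d * Real.exp (-t) ^ (m - d) := by
        rw [integral_add hind (integrable_const _),
          integral_indicator_const _ isClosed_closure.measurableSet]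
        simp [closedWetMeasure]

end UpperBound

section HullError

/-- The error term `ε_d(n)` in the upper bounds for the expected missed mass and the expected
number of boundary points. -/
noncomputable def hullError (d n : ℕ) : ℝ :=
  n * ((n + 2 * d) ^ d * Real.exp (-((d + 2) * (Real.log n / n))) ^ (n - 1 - d))

theorem exp_neg_log_div_pow_le {n : ℕ} (hn : 0 < n) (a k : ℕ) :
    Real.exp (-(a * (Real.log n / n))) ^ (n - k) ≤ Real.exp (a * k) / (n : ℝ) ^ a := by
  have hn0 : (0 : ℝ) < n := by exact_mod_cast hn
  have : 0 ≤ Real.log n / n := div_nonneg (Real.log_natCast_nonneg n) hn0.le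
  have hlog1 : Real.log n / n ≤ 1 :=
    (div_le_one hn0).2 ((Real.log_le_sub_one_of_pos hn0).trans (by linarith))
  have hsub : (n : ℝ) - k ≤ (n - k : ℕ) := by
    rw [sub_le_iff_le_add]
    exact_mod_cast (by omega : n ≤ n - k + k)
  calc Real.exp (-(a * (Real.log n / n))) ^ (n - k)
      = Real.exp (-((n - k : ℕ) * (a * (Real.log n / n)))) := by
        rw [← Real.exp_nat_mul, mul_neg]
    _ ≤ Real.exp (-((n - k) * (a * (Real.log n / n)))) := by gcongr
    _ = Real.exp (a * k * (Real.log n / n) - a * Real.log n) := by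
        congr 1
        field_simp
        ring
    _ ≤ Real.exp (a * k * 1 - a * Real.log n) := by gcongr
    _ = Real.exp (a * k) / (n : ℝ) ^ a := by
        rw [mul_one, Real.exp_sub, Real.exp_nat_mul (Real.log n), Real.exp_log hn0]

theorem hullError_le {d n : ℕ} (hn : 0 < n) :
    hullError d n ≤ (1 + 2 * d) ^ d * Real.exp ((d + 2) * (1 + d)) / n := by
  have hn1 : (1 : ℝ) ≤ n := by exact_mod_cast hn
  have hexp := exp_neg_log_div_pow_le hn (d + 2) (1 + d)
  push_cast at hexp
  rw [← Nat.sub_sub] at hexp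
  calc hullError d n
      ≤ n * ((n * (1 + 2 * d)) ^ d * (Real.exp ((d + 2) * (1 + d)) / (n : ℝ) ^ (d + 2))) := by
        unfold hullError
        gcongr
        nlinarith [Nat.cast_nonneg (α := ℝ) d]
    _ = (1 + 2 * d) ^ d * Real.exp ((d + 2) * (1 + d)) / n := by
        rw [mul_pow]
        field_simp
        ring

theorem tendsto_hullError (d : ℕ) : Tendsto (hullError d) atTop (𝓝 0) := by
  refine squeeze_zero' (Eventually.of_forall fun n => ?_) ?_
    (tendsto_const_div_atTop_nhds_zero_nat
      ((1 + 2 * d) ^ d * Real.exp (((d : ℝ) + 2) * (1 + d))))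
  · unfold hullError
    positivity
  · filter_upwards [eventually_gt_atTop 0] with n hn using hullError_le hn

end HullError

section Constants

theorem one_div_four_le_one_sub_one_div_pow {n : ℕ} (hn : 2 ≤ n) :
    (1 / 4 : ℝ) ≤ (1 - 1 / n) ^ n := by
  have hn2 : (2 : ℝ) ≤ n := by exact_mod_cast hn
  have hbase : (0 : ℝ) ≤ 1 - 1 / n := by
    rw [sub_nonneg, div_le_one (by linarith)]
    linarith
  have hhalf : (1 / 2 : ℝ) ≤ (1 - 1 / n) ^ ((n : ℝ) / 2) := by
    have hbernoulli := one_add_mul_self_le_rpow_one_add (s := -(1 / (n : ℝ))) (by linarith)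
      (p := (n : ℝ) / 2) (by linarith)
    rw [← sub_eq_add_neg] at hbernoulli
    refine le_of_eq_of_le ?_ hbernoulli
    field_simp
    norm_num
  calc (1 / 4 : ℝ) = (1 / 2) ^ 2 := by norm_num
    _ ≤ ((1 - 1 / n) ^ ((n : ℝ) / 2)) ^ 2 := by gcongr
    _ = (1 - 1 / n) ^ n := by
        rw [← Real.rpow_mul_natCast hbase, Nat.cast_ofNat, div_mul_cancel₀ _ two_ne_zero,
          Real.rpow_natCast]

theorem one_div_exp_one_le_one_sub_one_div_pow {n : ℕ} (hn : 2 ≤ n) :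
    1 / Real.exp 1 ≤ (1 - 1 / (n : ℝ)) ^ (n - 1) := by
  obtain ⟨m, rfl⟩ : ∃ m, n = m + 1 := ⟨n - 1, by omega⟩
  have hm : (0 : ℝ) < m := by exact_mod_cast (by omega : 0 < m)
  have hbase : 1 - 1 / ((m + 1 : ℕ) : ℝ) = 1 / (1 + 1 / m) := by
    push_cast
    field_simp
    ring
  rw [Nat.add_sub_cancel, hbase, one_div_pow]
  refine one_div_le_one_div_of_le (by positivity) ?_
  calc (1 + 1 / (m : ℝ)) ^ m ≤ Real.exp (1 / m) ^ m := by
        gcongr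
        linarith [Real.add_one_le_exp (1 / (m : ℝ))]
    _ = Real.exp 1 := by
        rw [← Real.exp_nat_mul, mul_one_div_cancel hm.ne']

end Constants

section Expectations

variable {d : ℕ} (μ : Measure (EuclideanSpace ℝ (Fin d))) [IsProbabilityMeasure μ] {n : ℕ}

theorem one_div_four_mul_closedWetMeasure_le_expectedMissedMass (hn : 2 ≤ n) :
    (1 / 4 : ℝ) * closedWetMeasure μ (1 / n) ≤ expectedMissedMass μ n := by
  have : NeZero n := ⟨by omega⟩
  have hn1 : 1 / (n : ℝ) ≤ 1 := by simpa only [one_div] using n.cast_inv_le_one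
  rw [expectedMissedMass_eq]
  exact (mul_le_mul_of_nonneg_right (one_div_four_le_one_sub_one_div_pow hn)
    measureReal_nonneg).trans (one_sub_pow_mul_closedWetMeasure_le μ hn1 n)

theorem expectedMissedMass_le (hn : 0 < n) :
    expectedMissedMass μ n ≤
      closedWetMeasure μ (((d : ℝ) + 2) * (Real.log n / n)) + hullError d n / n := by
  have : NeZero n := ⟨hn.ne'⟩
  have ht : 0 ≤ ((d : ℝ) + 2) * (Real.log n / n) := by positivity
  rw [expectedMissedMass_eq, hullError, mul_div_cancel_left₀ _ (NeZero.ne _)]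
  refine (integral_escapeProb_le μ ht n).trans ?_
  gcongr _ + _ * ?_
  exact pow_le_pow_of_le_one (Real.exp_pos _).le (Real.exp_le_one_iff.2 (by linarith)) (by omega)

theorem one_div_exp_one_mul_closedWetMeasure_le_expectedBoundaryCount (hn : 2 ≤ n) :
    (1 / Real.exp 1) * n * closedWetMeasure μ (1 / n) ≤ expectedBoundaryCount μ n := by
  have hn1 : 1 / (n : ℝ) ≤ 1 := by simpa only [one_div] using n.cast_inv_le_one
  rw [expectedBoundaryCount_eq, mul_comm _ (n : ℝ), mul_assoc]
  gcongr
  exact (mul_le_mul_of_nonneg_right (one_div_exp_one_le_one_sub_one_div_pow hn)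
    measureReal_nonneg).trans (one_sub_pow_mul_closedWetMeasure_le μ hn1 (n - 1))

variable (n) in
theorem expectedBoundaryCount_le :
    expectedBoundaryCount μ n ≤
      n * closedWetMeasure μ (((d : ℝ) + 2) * (Real.log n / n)) + hullError d n := by
  have ht : 0 ≤ ((d : ℝ) + 2) * (Real.log n / n) := by positivity
  rw [expectedBoundaryCount_eq, hullError, ← mul_add]
  gcongr
  refine (integral_escapeProb_le μ ht (n - 1)).trans ?_
  gcongr
  exact Nat.sub_le n 1

end Expectations

section RingMeasure

theorem exists_isProbabilityMeasure_measureReal_Ici_eq {q : ℕ → ℝ} (hq : Antitone q)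
    (hq0 : q 0 = 1) (hlim : Tendsto q atTop (𝓝 0)) :
    ∃ ρ : Measure ℕ, IsProbabilityMeasure ρ ∧ (∀ k, ρ.real (Set.Ici k) = q k) ∧
      ∀ k, ρ.real {k} = q k - q (k + 1) := by
  have hnonneg : ∀ k, 0 ≤ q k - q (k + 1) := fun k => sub_nonneg.2 (hq k.le_succ)
  have hsum : HasSum (fun k => q k - q (k + 1)) 1 := by
    rw [hasSum_iff_tendsto_nat_of_nonneg hnonneg]
    simpa only [Finset.sum_range_sub', hq0, sub_zero] using hlim.const_sub (q 0)
  let p : PMF ℕ := ⟨fun k => ENNReal.ofReal (q k - q (k + 1)), by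
    rw [ENNReal.summable.hasSum_iff, ← ENNReal.ofReal_tsum_of_nonneg hnonneg hsum.summable,
      hsum.tsum_eq, ENNReal.ofReal_one]⟩
  have hsingleton : ∀ k, p.toMeasure.real {k} = q k - q (k + 1) := fun k => by
    rw [measureReal_def, p.toMeasure_apply_singleton k (measurableSet_singleton k)]
    exact ENNReal.toReal_ofReal (hnonneg k)
  refine ⟨p.toMeasure, inferInstance, fun k => ?_, hsingleton⟩
  have hIci : Set.Ici k = (↑(Finset.range k))ᶜ := by
    ext j
    simp
  rw [hIci, probReal_compl_eq_one_sub (Finset.measurableSet _), ← sum_measureReal_singleton]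
  simp only [hsingleton, Finset.sum_range_sub', hq0, sub_sub_cancel]

variable {d : ℕ} (ρ : Measure ℕ) (σ : Measure (Metric.sphere (0 : EuclideanSpace ℝ (Fin d)) 1))

/-- The law of `4 ^ K • Y` for independent `K` and `Y` with laws `ρ` and `σ`: a measure carried by
concentric spheres whose radii grow so fast that a half-space meeting half the ball bounded by one
sphere cuts off a cap of definite size from it. -/
noncomputable def ringMeasure : Measure (EuclideanSpace ℝ (Fin d)) :=
  (ρ.prod σ).map fun p => (4 : ℝ) ^ p.1 • (p.2 : EuclideanSpace ℝ (Fin d))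

theorem measurable_pow_smul_sphere :
    Measurable fun p : ℕ × Metric.sphere (0 : EuclideanSpace ℝ (Fin d)) 1 =>
      (4 : ℝ) ^ p.1 • (p.2 : EuclideanSpace ℝ (Fin d)) :=
  ((measurable_of_countable fun k : ℕ => (4 : ℝ) ^ k).comp measurable_fst).smul
    (measurable_subtype_coe.comp measurable_snd)

theorem norm_pow_smul_sphere (k : ℕ) (y : Metric.sphere (0 : EuclideanSpace ℝ (Fin d)) 1) :
    ‖(4 : ℝ) ^ k • (y : EuclideanSpace ℝ (Fin d))‖ = 4 ^ k := by
  rw [norm_smul, norm_eq_of_mem_sphere]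
  simp

instance [SFinite σ] [NullSingletonClass σ] : NullSingletonClass (ringMeasure ρ σ) := by
  refine ⟨fun w => ?_⟩
  have hpreimage := measurable_pow_smul_sphere (measurableSet_singleton w)
  rw [ringMeasure, Measure.map_apply measurable_pow_smul_sphere (measurableSet_singleton w),
    Measure.measure_prod_null hpreimage]
  refine Eventually.of_forall fun k => Set.Subsingleton.measure_zero (fun y hy y' hy' => ?_) σ
  exact Subtype.ext (smul_right_injective _ (pow_ne_zero k four_ne_zero) (Eq.trans hy hy'.symm))

variable [IsProbabilityMeasure σ]

theorem ringMeasure_real_setOf_norm_mem {S : Set ℝ} (hS : MeasurableSet S) :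
    (ringMeasure ρ σ).real {y | ‖y‖ ∈ S} = ρ.real {k | (4 : ℝ) ^ k ∈ S} := by
  have hpreimage : (fun p : ℕ × Metric.sphere (0 : EuclideanSpace ℝ (Fin d)) 1 =>
      (4 : ℝ) ^ p.1 • (p.2 : EuclideanSpace ℝ (Fin d))) ⁻¹' {y | ‖y‖ ∈ S} =
        {k | (4 : ℝ) ^ k ∈ S} ×ˢ Set.univ := by
    ext p
    simp [norm_pow_smul_sphere]
  have hmeas : MeasurableSet {y : EuclideanSpace ℝ (Fin d) | ‖y‖ ∈ S} := measurable_norm hS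
  rw [ringMeasure, map_measureReal_apply measurable_pow_smul_sphere hmeas, hpreimage,
    measureReal_prod_prod, probReal_univ, mul_one]

variable [IsProbabilityMeasure ρ]

instance : IsProbabilityMeasure (ringMeasure ρ σ) :=
  Measure.isProbabilityMeasure_map measurable_pow_smul_sphere.aemeasurable

theorem one_sub_pow_mul_measureReal_Ici_le_integral_escapeProb (k m : ℕ) :
    (1 - ρ.real (Set.Ici (k + 1))) ^ m * ρ.real (Set.Ici k) ≤
      ∫ z, escapeProb (ringMeasure ρ σ) m z ∂ringMeasure ρ σ := by
  have hball : (ringMeasure ρ σ).real {y | ‖y‖ ∈ Set.Iic (4 ^ k)} =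
      1 - ρ.real (Set.Ici (k + 1)) := by
    rw [ringMeasure_real_setOf_norm_mem ρ σ measurableSet_Iic,
      ← probReal_compl_eq_one_sub (measurableSet_Ici)]
    congr 1
    ext j
    simp [pow_le_pow_iff_right₀]
  have houtside : (ringMeasure ρ σ).real {y | ‖y‖ ∈ Set.Ici (4 ^ k)} = ρ.real (Set.Ici k) := by
    rw [ringMeasure_real_setOf_norm_mem ρ σ measurableSet_Ici]
    congr 1
    ext j
    simp [pow_le_pow_iff_right₀]
  rw [← houtside, ← hball]
  refine mul_measureReal_le_integral_escapeProb _ (by positivity) fun z hz => ?_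
  have hz' : (4 : ℝ) ^ k ≤ ‖z‖ := hz
  have hz0 : 0 < ‖z‖ := lt_of_lt_of_le (by positivity) hz'
  refine le_trans ?_ (pow_measureReal_le_escapeProb _ m (neg_ne_zero.2 (norm_pos_iff.1 hz0)) z)
  refine pow_le_pow_left₀ measureReal_nonneg (measureReal_mono fun y hy => ?_) m
  have hyz : inner ℝ z y ≤ ‖z‖ * ‖z‖ :=
    (real_inner_le_norm z y).trans (by gcongr; exact le_trans hy hz')
  simpa [inner_sub_right, pow_two] using hyz

variable {ρ σ} {c : ℝ}

theorem mul_measureReal_singleton_le_ringMeasure_real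
    (hcap : ∀ u, c ≤ σ.real {y | ‖u‖ / 2 ≤ inner ℝ u (y : EuclideanSpace ℝ (Fin d))}) {k : ℕ}
    {h : Set (EuclideanSpace ℝ (Fin d))} (hh : IsClosedHalfspace h)
    {w : EuclideanSpace ℝ (Fin d)} (hwh : w ∈ h) (hw : ‖w‖ ≤ 4 ^ k / 2) :
    c * ρ.real {k} ≤ (ringMeasure ρ σ).real h := by
  rw [ringMeasure, map_measureReal_apply measurable_pow_smul_sphere hh.measurableSet]
  obtain ⟨u, b, -, rfl⟩ := hh
  calc c * ρ.real {k}
      ≤ σ.real {y | ‖-u‖ / 2 ≤ inner ℝ (-u) (y : EuclideanSpace ℝ (Fin d))} * ρ.real {k} :=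
        mul_le_mul_of_nonneg_right (hcap (-u)) measureReal_nonneg
    _ = (ρ.prod σ).real
          ({k} ×ˢ {y | ‖-u‖ / 2 ≤ inner ℝ (-u) (y.1 : EuclideanSpace ℝ (Fin d))}) := by
        rw [measureReal_prod_prod, mul_comm]
    _ ≤ _ := measureReal_mono ?_
  rintro ⟨j, y⟩ ⟨rfl : j = k, hy⟩
  have hwb : inner ℝ u w ≤ b := hwh
  have hwu : -(‖u‖ * (4 ^ j / 2)) ≤ inner ℝ u w :=
    (neg_le_neg (by gcongr)).trans (neg_le_of_abs_le (abs_real_inner_le_norm u w))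
  have hyu : (4 : ℝ) ^ j * (‖u‖ / 2) ≤ 4 ^ j * -inner ℝ u (y : EuclideanSpace ℝ (Fin d)) := by
    gcongr
    simpa using hy
  simp only [Set.mem_preimage, Set.mem_ofPred_eq, real_inner_smul_right]
  linarith

theorem closedWetMeasure_ringMeasure_le
    (hcap : ∀ u, c ≤ σ.real {y | ‖u‖ / 2 ≤ inner ℝ u (y : EuclideanSpace ℝ (Fin d))}) {k : ℕ}
    {t : ℝ} (ht : t < c * ρ.real {k}) :
    closedWetMeasure (ringMeasure ρ σ) t ≤ ρ.real (Set.Ici k) := by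
  have hindex : {j : ℕ | (4 : ℝ) ^ j ∈ Set.Ici (4 ^ k / 2)} ⊆ Set.Ici k := by
    intro j hj
    by_contra hlt
    have hpow : (4 : ℝ) ^ (j + 1) ≤ 4 ^ k :=
      pow_le_pow_right₀ (by norm_num) (Nat.succ_le_of_lt (not_le.1 hlt))
    have hj' : (4 : ℝ) ^ k / 2 ≤ 4 ^ j := hj
    have : (0 : ℝ) < 4 ^ j := by positivity
    rw [pow_succ] at hpow
    linarith
  refine le_trans (measureReal_mono (closure_minimal ?_
    (isClosed_Ici.preimage continuous_norm))) ((ringMeasure_real_setOf_norm_mem ρ σ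
      (S := Set.Ici (4 ^ k / 2)) measurableSet_Ici).trans_le (measureReal_mono hindex))
  rintro w ⟨h, hh, hwh, hht⟩
  by_contra hw
  have hcap_le := mul_measureReal_singleton_le_ringMeasure_real (ρ := ρ) hcap hh hwh
    (not_le.1 hw).le
  linarith

theorem half_mul_closedWetMeasure_ringMeasure_lt_integral_escapeProb
    (hcap : ∀ u, c ≤ σ.real {y | ‖u‖ / 2 ≤ inner ℝ u (y : EuclideanSpace ℝ (Fin d))}) {k n : ℕ}
    {t : ℝ} (ht : t < c * ρ.real {k}) (hk : 0 < ρ.real (Set.Ici k))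
    (hn : 1 / 2 < (1 - ρ.real (Set.Ici (k + 1))) ^ n) :
    1 / 2 * closedWetMeasure (ringMeasure ρ σ) t <
      ∫ z, escapeProb (ringMeasure ρ σ) n z ∂ringMeasure ρ σ :=
  calc 1 / 2 * closedWetMeasure (ringMeasure ρ σ) t
      ≤ 1 / 2 * ρ.real (Set.Ici k) := by
        gcongr
        exact closedWetMeasure_ringMeasure_le hcap ht
    _ < (1 - ρ.real (Set.Ici (k + 1))) ^ n * ρ.real (Set.Ici k) := by gcongr
    _ ≤ _ := one_sub_pow_mul_measureReal_Ici_le_integral_escapeProb ρ σ k n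

end RingMeasure

section CircleLaw

theorem norm_cos_sin (θ : ℝ) : ‖!₂[Real.cos θ, Real.sin θ]‖ = 1 := by
  simp [EuclideanSpace.norm_eq]

/-- The point at angle `θ` on the unit circle. -/
noncomputable def circlePoint (θ : ℝ) : Metric.sphere (0 : EuclideanSpace ℝ (Fin 2)) 1 :=
  ⟨!₂[Real.cos θ, Real.sin θ], mem_sphere_zero_iff_norm.2 (norm_cos_sin θ)⟩

theorem measurable_circlePoint : Measurable circlePoint := by
  refine Measurable.subtype_mk ((PiLp.continuous_toLp 2 _).comp ?_).measurable
  refine continuous_pi fun i => ?_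
  fin_cases i
  exacts [Real.continuous_cos, Real.continuous_sin]

theorem countable_circlePoint_preimage_singleton
    (y : Metric.sphere (0 : EuclideanSpace ℝ (Fin 2)) 1) : (circlePoint ⁻¹' {y}).Countable := by
  rcases (circlePoint ⁻¹' {y}).eq_empty_or_nonempty with hempty | ⟨ψ, rfl⟩
  · exact hempty ▸ Set.countable_empty
  · refine (Set.countable_range fun n : ℤ => ψ + 2 * Real.pi * n).mono fun θ hθ => ?_
    have hpoint : (circlePoint θ).1 = (circlePoint ψ).1 := congrArg Subtype.val hθ
    have hcos : Real.cos θ = Real.cos ψ := congrArg (· 0) hpoint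
    have hsin : Real.sin θ = Real.sin ψ := congrArg (· 1) hpoint
    obtain ⟨n, hn⟩ := Real.Angle.angle_eq_iff_two_pi_dvd_sub.1 (Real.Angle.cos_sin_inj hcos hsin)
    exact ⟨n, by linarith⟩

theorem exists_eq_norm_smul_circlePoint (u : EuclideanSpace ℝ (Fin 2)) :
    ∃ φ : ℝ, |φ| ≤ Real.pi ∧ u = ‖u‖ • (circlePoint φ : EuclideanSpace ℝ (Fin 2)) := by
  let z : ℂ := ⟨u 0, u 1⟩
  have hnorm : ‖z‖ = ‖u‖ := by
    simp [z, EuclideanSpace.norm_eq, Complex.norm_eq_sqrt_sq_add_sq]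
  refine ⟨z.arg, Complex.abs_arg_le_pi z, ?_⟩
  ext i
  rw [← hnorm]
  fin_cases i
  · exact (Complex.norm_mul_cos_arg z).symm
  · exact (Complex.norm_mul_sin_arg z).symm

theorem inner_circlePoint (φ θ : ℝ) :
    inner ℝ (circlePoint φ : EuclideanSpace ℝ (Fin 2)) (circlePoint θ) = Real.cos (θ - φ) := by
  rw [Real.cos_sub, PiLp.inner_apply]
  simp [circlePoint]

/-- The law of the point at a uniformly distributed angle in `[-5, 5]`. Since `π < 4`, this
interval contains `[φ, φ + 1]` for every `φ ∈ [-π, π]`, so arcs need not be taken modulo `2π`. -/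
noncomputable def circleLaw : Measure (Metric.sphere (0 : EuclideanSpace ℝ (Fin 2)) 1) :=
  (volume : Measure unitInterval).map fun v : unitInterval => circlePoint (10 * v - 5)

theorem measurable_circlePoint_affine :
    Measurable fun v : unitInterval => circlePoint (10 * v - 5) :=
  measurable_circlePoint.comp (by fun_prop)

instance : IsProbabilityMeasure circleLaw :=
  Measure.isProbabilityMeasure_map measurable_circlePoint_affine.aemeasurable

instance : NullSingletonClass circleLaw := by
  refine ⟨fun y => ?_⟩
  have hinj : Function.Injective fun v : unitInterval => 10 * (v : ℝ) - 5 :=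
    fun v w h => Subtype.ext (by simp only at h; linarith)
  rw [circleLaw, Measure.map_apply measurable_circlePoint_affine (measurableSet_singleton y)]
  exact ((countable_circlePoint_preimage_singleton y).preimage hinj).measure_zero _

theorem one_div_ten_le_circleLaw_cap (u : EuclideanSpace ℝ (Fin 2)) :
    1 / 10 ≤ circleLaw.real {y | ‖u‖ / 2 ≤ inner ℝ u (y : EuclideanSpace ℝ (Fin 2))} := by
  obtain ⟨φ, hφ, hu⟩ := exists_eq_norm_smul_circlePoint u
  obtain ⟨hφ_ge, hφ_le⟩ := abs_le.1 hφ
  have hπ : Real.pi < 4 := Real.pi_lt_four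
  let a : unitInterval := ⟨(φ + 5) / 10, by constructor <;> linarith⟩
  let b : unitInterval := ⟨(φ + 6) / 10, by constructor <;> linarith⟩
  have harc : Set.Icc a b ⊆ (fun v : unitInterval => circlePoint (10 * v - 5)) ⁻¹'
      {y | ‖u‖ / 2 ≤ inner ℝ u (y : EuclideanSpace ℝ (Fin 2))} := by
    rintro v ⟨hav, hvb⟩
    replace hav : (φ + 5) / 10 ≤ v := hav
    replace hvb : v ≤ (φ + 6) / 10 := hvb
    have hcos : 1 / 2 ≤ Real.cos (10 * v - 5 - φ) := by
      nlinarith [Real.one_sub_sq_div_two_le_cos (x := 10 * v - 5 - φ)]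
    rw [Set.mem_preimage, Set.mem_ofPred_eq, hu, real_inner_smul_left, inner_circlePoint, ← hu]
    nlinarith [norm_nonneg u]
  have hmeas : MeasurableSet {y : Metric.sphere (0 : EuclideanSpace ℝ (Fin 2)) 1 |
      ‖u‖ / 2 ≤ inner ℝ u (y : EuclideanSpace ℝ (Fin 2))} :=
    measurableSet_le measurable_const (by fun_prop)
  rw [circleLaw, map_measureReal_apply measurable_circlePoint_affine hmeas]
  refine le_trans (le_of_eq ?_) (measureReal_mono harc)
  rw [measureReal_def, unitInterval.volume_Icc, ENNReal.toReal_ofReal]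
  · simp only [a, b]
    ring
  · simp only [a, b]
    linarith

end CircleLaw

section RingTail

/-- The mass `2 * 2 ^ (-3 ^ k)` of the rings of index at least `k`. At the sample size
`n = 4 ^ 3 ^ k` the `k`-th ring alone keeps mass much larger than `log n / n`, while the
expected number of sample points on all later rings is still negligible. -/
noncomputable def ringTail (k : ℕ) : ℝ := 2 * (1 / 2) ^ 3 ^ k

theorem antitone_ringTail : Antitone ringTail := fun k l hkl => by
  unfold ringTail
  gcongr ?_ * ?_
  exact pow_le_pow_of_le_one (by norm_num) (by norm_num) (Nat.pow_le_pow_right (by norm_num) hkl)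

theorem tendsto_ringTail : Tendsto ringTail atTop (𝓝 0) := by
  have hpow : Tendsto (fun a : ℕ => (1 / 2 : ℝ) ^ a) atTop (𝓝 0) :=
    tendsto_pow_atTop_nhds_zero_of_lt_one (by norm_num) (by norm_num)
  simpa only [mul_zero] using!
    (hpow.comp (tendsto_pow_atTop_atTop_of_one_lt (by norm_num : 1 < 3))).const_mul 2

theorem ringTail_pos (k : ℕ) : 0 < ringTail k := by
  unfold ringTail
  positivity

theorem forty_mul_lt_two_pow {a : ℕ} (ha : 9 ≤ a) : 40 * a < 2 ^ a := by
  induction a, ha using Nat.le_induction with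
  | base => norm_num
  | succ a ha ih => rw [pow_succ]; omega

theorem four_pow_mul_ringTail_succ (k : ℕ) :
    ((4 ^ 3 ^ k : ℕ) : ℝ) * ringTail (k + 1) = ringTail k := by
  have hcancel : (4 : ℝ) ^ 3 ^ k * ((1 / 2) ^ 3 ^ k) ^ 2 = 1 := by
    rw [← pow_mul, mul_comm (3 ^ k), pow_mul, ← mul_pow]
    norm_num
  have hcube : (1 / 2 : ℝ) ^ 3 ^ (k + 1) = ((1 / 2) ^ 3 ^ k) ^ 3 := by rw [pow_succ, pow_mul]
  unfold ringTail
  push_cast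
  rw [hcube]
  linear_combination 2 * (1 / 2) ^ 3 ^ k * hcancel

theorem ringTail_le_one_div_four {k : ℕ} (hk : 1 ≤ k) : ringTail k ≤ 1 / 4 := by
  refine (antitone_ringTail hk).trans ?_
  norm_num [ringTail]

theorem logb_div_lt_ringTail_sub {k : ℕ} (hk : 2 ≤ k) :
    Real.logb 2 ((4 ^ 3 ^ k : ℕ) : ℝ) / ((4 ^ 3 ^ k : ℕ) : ℝ) <
      1 / 10 * (ringTail k - ringTail (k + 1)) := by
  have hlog : Real.logb 2 ((4 ^ 3 ^ k : ℕ) : ℝ) = 2 * (3 ^ k : ℕ) := by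
    have : ((4 ^ 3 ^ k : ℕ) : ℝ) = 2 ^ (2 * 3 ^ k) := by
      rw [pow_mul]
      norm_num
    rw [this, Real.logb_pow, Real.logb_self_eq_one one_lt_two]
    push_cast
    ring
  have hpow : ((4 ^ 3 ^ k : ℕ) : ℝ) * ringTail k = 2 * 2 ^ 3 ^ k := by
    have : (4 : ℝ) ^ 3 ^ k * (1 / 2) ^ 3 ^ k = 2 ^ 3 ^ k := by
      rw [← mul_pow]
      norm_num
    unfold ringTail
    push_cast
    linear_combination 2 * this
  have hexp : 40 * ((3 ^ k : ℕ) : ℝ) < 2 ^ 3 ^ k := by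
    exact_mod_cast forty_mul_lt_two_pow (Nat.pow_le_pow_right (by norm_num : 0 < 3) hk)
  have hone : (1 : ℝ) ≤ 2 ^ 3 ^ k := one_le_pow₀ one_le_two
  rw [div_lt_iff₀ (by positivity), hlog, mul_assoc, sub_mul, mul_comm (ringTail k), hpow,
    mul_comm (ringTail (k + 1)), four_pow_mul_ringTail_succ]
  linarith [ringTail_le_one_div_four (one_le_two.trans hk)]

theorem half_lt_one_sub_ringTail_succ_pow {k m : ℕ} (hk : 1 ≤ k) (hm : m ≤ 4 ^ 3 ^ k) :
    1 / 2 < (1 - ringTail (k + 1)) ^ m := by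
  have hsmall : ringTail (k + 1) ≤ 1 / 4 := ringTail_le_one_div_four (by omega)
  have hmul : m * ringTail (k + 1) ≤ ringTail k := by
    rw [← four_pow_mul_ringTail_succ k]
    exact mul_le_mul_of_nonneg_right (by exact_mod_cast hm) (ringTail_pos _).le
  have hbernoulli := one_add_mul_le_pow (a := -ringTail (k + 1)) (by linarith) m
  rw [← sub_eq_add_neg] at hbernoulli
  linarith [ringTail_le_one_div_four hk]

end RingTail

theorem exists_half_closedWetMeasure_lt_expectations :
    ∃ ν : Measure (EuclideanSpace ℝ (Fin 2)), IsProbabilityMeasure ν ∧ (∀ p, ν {p} = 0) ∧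
      ∃ᶠ n : ℕ in atTop,
        expectedMissedMass ν n > (1 / 2 : ℝ) * closedWetMeasure ν (Real.logb 2 n / n) ∧
        expectedBoundaryCount ν n >
          (1 / 2 : ℝ) * n * closedWetMeasure ν (Real.logb 2 n / n) := by
  obtain ⟨ρ, _, hIci, hsingleton⟩ :=
    exists_isProbabilityMeasure_measureReal_Ici_eq antitone_ringTail (by norm_num [ringTail])
      tendsto_ringTail
  refine ⟨ringMeasure ρ circleLaw, inferInstance, measure_singleton, ?_⟩
  rw [frequently_atTop]
  intro N
  have hN : N ≤ 4 ^ 3 ^ (N + 2) := by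
    have h3 : N + 2 < 3 ^ (N + 2) := Nat.lt_pow_self (by norm_num)
    have h4 : 3 ^ (N + 2) < 4 ^ 3 ^ (N + 2) := Nat.lt_pow_self (by norm_num)
    omega
  have hescape : ∀ m ≤ 4 ^ 3 ^ (N + 2), 1 / 2 * closedWetMeasure (ringMeasure ρ circleLaw)
      (Real.logb 2 ((4 ^ 3 ^ (N + 2) : ℕ) : ℝ) / ((4 ^ 3 ^ (N + 2) : ℕ) : ℝ)) <
        ∫ z, escapeProb (ringMeasure ρ circleLaw) m z ∂ringMeasure ρ circleLaw := fun m hm =>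
    half_mul_closedWetMeasure_ringMeasure_lt_integral_escapeProb one_div_ten_le_circleLaw_cap
      (hsingleton _ ▸ logb_div_lt_ringTail_sub (by omega)) (hIci _ ▸ ringTail_pos _)
      (hIci _ ▸ half_lt_one_sub_ringTail_succ_pow (by omega) hm)
  refine ⟨4 ^ 3 ^ (N + 2), hN, ?_, ?_⟩
  · rw [expectedMissedMass_eq]
    exact hescape _ le_rfl
  · rw [expectedBoundaryCount_eq, mul_comm (1 / 2 : ℝ), mul_assoc]
    exact mul_lt_mul_of_pos_left (hescape _ (Nat.sub_le _ _)) (by positivity)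

theorem theorem5 :
    (∀ d : ℕ, ∃ ε : ℕ → ℝ, Tendsto ε atTop (𝓝 0) ∧
      ∀ (μ : Measure (EuclideanSpace ℝ (Fin d))), IsProbabilityMeasure μ → ∀ n : ℕ, 2 ≤ n →
        (Integrable (fun x : Fin n → EuclideanSpace ℝ (Fin d) => missedMass μ x) (sampleLaw μ n) ∧
          (1 / 4 : ℝ) * closedWetMeasure μ (1 / n) ≤ expectedMissedMass μ n ∧
          expectedMissedMass μ n ≤
            closedWetMeasure μ (((d : ℝ) + 2) * (Real.log n / n)) + ε n / n) ∧
        (Integrable (fun x : Fin n → EuclideanSpace ℝ (Fin d) => (boundaryCount x : ℝ))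
            (sampleLaw μ n) ∧
          (1 / Real.exp 1) * n * closedWetMeasure μ (1 / n) ≤ expectedBoundaryCount μ n ∧
          expectedBoundaryCount μ n ≤
            n * closedWetMeasure μ (((d : ℝ) + 2) * (Real.log n / n)) + ε n)) ∧
    (∃ ν : Measure (EuclideanSpace ℝ (Fin 2)), IsProbabilityMeasure ν ∧ (∀ p, ν {p} = 0) ∧
      ∃ᶠ n : ℕ in atTop,
        expectedMissedMass ν n > (1 / 2 : ℝ) * closedWetMeasure ν (Real.logb 2 n / n) ∧
        expectedBoundaryCount ν n >
          (1 / 2 : ℝ) * n * closedWetMeasure ν (Real.logb 2 n / n)) := by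
  refine ⟨fun d => ⟨hullError d, tendsto_hullError d, fun μ _ n hn => ?_⟩,
    exists_half_closedWetMeasure_lt_expectations⟩
  have : NeZero n := ⟨by omega⟩
  exact ⟨⟨integrable_missedMass μ n,
      one_div_four_mul_closedWetMeasure_le_expectedMissedMass μ hn,
      expectedMissedMass_le μ (by omega)⟩,
    integrable_boundaryCount μ n,
    one_div_exp_one_mul_closedWetMeasure_le_expectedBoundaryCount μ hn,
    expectedBoundaryCount_le μ n⟩
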